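/- Let $n\ge 0$, let $\mathcal M$ be a loop-free matroid on $[n]=\{1,\dots,n\}$, let $\mathbb K$ be a field, and let $\beta_{i,j}\in\mathbb K^*$ for $i<j$. Let $\mathcal E$ be the $\mathbb K$-algebra generated by $e_1,\dots,e_n$ with the relations $e_i^2=0$ and $e_je_i=\beta_{i,j}e_ie_j$ for $i<j$. For $X=\{i_1<\dots<i_m\}\subseteq[n]$ put $e_X=e_{i_1}\cdots e_{i_m}$ (with $e_\emptyset=1$); the monomials $e_X$ form a $\mathbb K$-basis of $\mathcal E$. For $\chi:2^{[n]}\to\mathbb K$ put $$\partial e_X=\sum_{p=1}^m(-1)^p\chi(X\setminus i_p)\,e_{X\setminus i_p}\quad(m\ge 2),\qquad \partial e_i=1 .$$ A set $U\subseteq[n]$ is unidependent if it contains exactly one circuit of $\mathcal M$. Suppose that $\chi(I)\ne 0$ if and only if $I$ is independent, and that for all unidependent sets $U'\subseteq U$ there is $\varepsilon\in\mathbb K^*$ with $\partial e_U=\varepsilon\,(\partial e_{U'})\,e_{U\setminus U'}$. Let $\mathfrak I_\chi(\mathcal M)$ be the right ideal of $\mathcal E$ generated by the $\partial e_C$ with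 $C$ a circuit of $\mathcal M$, $|C|>1$ (and by the $e_i$ with $i$ a loop, of which there are none here), and let $\mathbb A_\chi(\mathcal M)=\mathcal E/\mathfrak I_\chi(\mathcal M)$ be the $\chi$-algebra, regarded as a $\mathbb K$-module. A term order is a total order $\prec$ on the monomials $e_X$ with least element $e_\emptyset=1$ such that, whenever $e_X\prec e_Y$ and $e_Xe_Z\ne 0\ne e_Ye_Z$, the monomial $e_{X\cup Z}$ of $e_Xe_Z$ precedes the monomial $e_{Y\cup Z}$ of $e_Ye_Z$. The leading monomial $\mathrm{lp}_\prec(f)$ of $f\neq 0$ is the $\prec$-largest monomial occurring in $f$, and $\mathrm{Lt}_\prec(S)$ is the ideal generated by the leading monomials of the nonzero elements of $S\subseteq\mathcal E$. A Gröbner basis of $\mathfrak I_\chi(\mathcal M)$ with respect to $\prec$ is a set $\mathcal G\subseteq\mathfrak I_\chi(\mathcal M)\setminus\{0\}$ with $\mathrm{Lt}_\prec(\mathcal G)=\mathrm{Lt}_\prec(\mathfrak I_\chi(\mathcal M))$; it is reduced if all its elements have leading coefficient $1$ and, for distinct $g,g'\in\mathcal G$, no term of $g'$ is divisible by $\mathrm{lp}_\prec(g)$.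 The canonical basis for $\prec$ is $$\mathcal B_\prec=\{e_X+\mathfrak I_\chi(\mathcal M):\ e_X\notin\mathrm{Lt}_\prec(\mathfrak I_\chi(\mathcal M))\},$$ and the canonical basis for a Gröbner basis $\mathcal G$ with respect to $\prec$ is $$\mathcal B_{\mathcal G}=\{e_X+\mathfrak I_\chi(\mathcal M):\ e_X\notin\mathrm{Lt}_\prec(\mathcal G)\}.$$ For a permutation $\pi$ of $[n]$ let $i<_\pi j$ mean $\pi(i)<\pi(j)$. A $\pi$-broken circuit is a set $C\setminus\min_{<_\pi}(C)$ with $C$ a circuit, $|C|>1$. The $\pi$-no-broken-circuit basis $\pi\text{-}\boldsymbol{nbc}(\mathcal M)$ is the set of the classes $e_X+\mathfrak I_\chi(\mathcal M)$ of those $X\subseteq[n]$ that contain no $\pi$-broken circuit. Let $\mathcal B\subseteq\mathbb A_\chi(\mathcal M)$ be a basis of the $\mathbb K$-module $\mathbb A_\chi(\mathcal M)$. Then the following are equivalent: 1. $\mathcal B=\mathcal B_\prec$ for some term order $\prec$; 2. $\mathcal B=\pi\text{-}\boldsymbol{nbc}(\mathcal M)$ for some permutation $\pi$ of $[n]$;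 3. $\mathcal B=\mathcal B_{\mathcal G_r}$ for some reduced Gröbner basis $\mathcal G_r$ of $\mathfrak I_\chi(\mathcal M)$ (with respect to some term order). -/

import Mathlib

open scoped MulOpposite

noncomputable section

/-- The scalar `c(X, Y)` with `e_X * e_Y = c(X, Y) e_{X ∪ Y}` for disjoint `X, Y`, produced by sorting
the product with the rule `e_j * e_i = β_{i,j} e_i * e_j` for `i < j`. -/
def skewCoeff {n : ℕ} {K : Type*} [Field K] (β : Fin n → Fin n → Kˣ) (X Y : Finset (Fin n)) : K :=
  ∏ i ∈ X, ∏ j ∈ Y, if j < i then (β j i : K) else 1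

/-- The algebra over `K` generated by `e_1, …, e_n` with the relations `e_i ^ 2 = 0` and
`e_j * e_i = β_{i,j} e_i * e_j` for `i < j`, realised on its basis of monomials `e_X`, `X ⊆ [n]`:
an element is the family of its coefficients. (Only the values `β i j` with `i < j` matter.) -/
def SkewAlgebra {n : ℕ} {K : Type*} [Field K] (_β : Fin n → Fin n → Kˣ) : Type _ :=
  Finset (Fin n) → K

namespace SkewAlgebra

variable {n : ℕ} {K : Type*} [Field K] {β : Fin n → Fin n → Kˣ}

instance : AddCommGroup (SkewAlgebra β) := inferInstanceAs (AddCommGroup (Finset (Fin n) → K))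

instance : Module K (SkewAlgebra β) := inferInstanceAs (Module K (Finset (Fin n) → K))

/-- The coefficient of `e_X` in `f`. -/
def coeff (f : SkewAlgebra β) (X : Finset (Fin n)) : K := f X

@[ext] theorem ext {f g : SkewAlgebra β} (h : ∀ X, f.coeff X = g.coeff X) : f = g := funext h

@[simp] theorem coeff_zero (X : Finset (Fin n)) : (0 : SkewAlgebra β).coeff X = 0 := rfl

@[simp] theorem coeff_add (f g : SkewAlgebra β) (X : Finset (Fin n)) :
    (f + g).coeff X = f.coeff X + g.coeff X := rfl

@[simp] theorem coeff_smul (a : K) (f : SkewAlgebra β) (X : Finset (Fin n)) :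
    (a • f).coeff X = a * f.coeff X := rfl

variable (β) in
/-- The monomial `e_X`, the product of the `e_i`, `i ∈ X`, in increasing order. -/
def mono (X : Finset (Fin n)) : SkewAlgebra β := fun Y => if Y = X then 1 else 0

theorem coeff_mono (X Y : Finset (Fin n)) : (mono β X).coeff Y = if Y = X then 1 else 0 := rfl

instance : One (SkewAlgebra β) := ⟨mono β ∅⟩

instance : Mul (SkewAlgebra β) :=
  ⟨fun f g Z => ∑ X ∈ Z.powerset, skewCoeff β X (Z \ X) * (f.coeff X * g.coeff (Z \ X))⟩

theorem one_def : (1 : SkewAlgebra β) = mono β ∅ := rfl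

theorem coeff_mul (f g : SkewAlgebra β) (Z : Finset (Fin n)) :
    (f * g).coeff Z =
      ∑ X ∈ Z.powerset, skewCoeff β X (Z \ X) * (f.coeff X * g.coeff (Z \ X)) := rfl

theorem skewCoeff_ne_zero (X Y : Finset (Fin n)) : skewCoeff β X Y ≠ 0 := by
  refine Finset.prod_ne_zero_iff.2 fun i _ => Finset.prod_ne_zero_iff.2 fun j _ => ?_
  split_ifs <;> simp

@[simp] theorem skewCoeff_empty_left (X : Finset (Fin n)) : skewCoeff β ∅ X = 1 := by
  simp [skewCoeff]

@[simp] theorem skewCoeff_empty_right (X : Finset (Fin n)) : skewCoeff β X ∅ = 1 := by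
  simp [skewCoeff]

theorem skewCoeff_union_left {X Y : Finset (Fin n)} (h : Disjoint X Y) (Z : Finset (Fin n)) :
    skewCoeff β (X ∪ Y) Z = skewCoeff β X Z * skewCoeff β Y Z := by
  simp [skewCoeff, Finset.prod_union h]

theorem skewCoeff_union_right (X : Finset (Fin n)) {Y Z : Finset (Fin n)} (h : Disjoint Y Z) :
    skewCoeff β X (Y ∪ Z) = skewCoeff β X Y * skewCoeff β X Z := by
  simp [skewCoeff, Finset.prod_union h, Finset.prod_mul_distrib]

theorem mul_assoc' (f g h : SkewAlgebra β) : f * g * h = f * (g * h) := by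
  ext Z
  simp only [coeff_mul, Finset.mul_sum, Finset.sum_mul]
  rw [Finset.sum_sigma', Finset.sum_sigma']
  refine Finset.sum_bij' (fun p _ => ⟨p.2, p.1 \ p.2⟩) (fun p _ => ⟨p.1 ∪ p.2, p.1⟩) ?_ ?_ ?_ ?_ ?_
  · rintro ⟨W, X⟩ hp
    simp only [Finset.mem_sigma, Finset.mem_powerset] at hp ⊢
    exact ⟨hp.2.trans hp.1, Finset.sdiff_subset_sdiff hp.1 subset_rfl⟩
  · rintro ⟨X, Y⟩ hp
    simp only [Finset.mem_sigma, Finset.mem_powerset] at hp ⊢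
    exact ⟨Finset.union_subset hp.1 (hp.2.trans Finset.sdiff_subset), Finset.subset_union_left⟩
  · rintro ⟨W, X⟩ hp
    simp only [Finset.mem_sigma, Finset.mem_powerset] at hp
    simp [Finset.union_eq_right.2 hp.2]
  · rintro ⟨X, Y⟩ hp
    simp only [Finset.mem_sigma, Finset.mem_powerset] at hp
    have : Disjoint Y X := (Finset.disjoint_sdiff.mono_right hp.2).symm
    simp [Finset.union_sdiff_left, Finset.sdiff_eq_self_of_disjoint this]
  · rintro ⟨W, X⟩ hp
    simp only [Finset.mem_sigma, Finset.mem_powerset] at hp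
    obtain ⟨h1, h2⟩ := hp
    have e1 : W = X ∪ (W \ X) := by simp [Finset.union_eq_right.2 h2]
    have e2 : Z \ X = (W \ X) ∪ (Z \ W) := by
      ext a; simp only [Finset.mem_sdiff, Finset.mem_union]
      have := @h1 a; have := @h2 a; tauto
    have e3 : (Z \ X) \ (W \ X) = Z \ W := by
      ext a; simp only [Finset.mem_sdiff]
      have := @h1 a; have := @h2 a; tauto
    have d1 : Disjoint X (W \ X) := Finset.disjoint_sdiff
    have d2 : Disjoint (W \ X) (Z \ W) :=
      Finset.disjoint_sdiff.mono_left (Finset.sdiff_subset)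
    have c1 : skewCoeff β W (Z \ W) = skewCoeff β X (Z \ W) * skewCoeff β (W \ X) (Z \ W) := by
      conv_lhs => rw [e1]
      rw [← e1, ← skewCoeff_union_left d1, ← e1]
    have c2 : skewCoeff β X (Z \ X) = skewCoeff β X (W \ X) * skewCoeff β X (Z \ W) := by
      rw [e2, skewCoeff_union_right X d2]
    simp only [e3, c1, c2]
    ring

theorem one_mul' (f : SkewAlgebra β) : 1 * f = f := by
  ext Z
  rw [coeff_mul, Finset.sum_eq_single ∅]
  · simp [one_def, coeff_mono]
  · intro X _ hX
    simp [one_def, coeff_mono, hX]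
  · simp

theorem mul_one' (f : SkewAlgebra β) : f * 1 = f := by
  ext Z
  rw [coeff_mul, Finset.sum_eq_single Z]
  · simp [one_def, coeff_mono]
  · intro X hX hne
    have : Z \ X ≠ ∅ := fun h =>
      hne (subset_antisymm (Finset.mem_powerset.1 hX) (Finset.sdiff_eq_empty_iff_subset.1 h))
    simp [one_def, coeff_mono, this]
  · simp

instance : Ring (SkewAlgebra β) :=
  { (inferInstance : AddCommGroup (SkewAlgebra β)) with
    mul := (· * ·)
    one := 1
    mul_assoc := mul_assoc'
    one_mul := one_mul'
    mul_one := mul_one'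
    left_distrib := fun f g h => by
      ext Z; simp [coeff_mul, mul_add, Finset.sum_add_distrib]
    right_distrib := fun f g h => by
      ext Z; simp [coeff_mul, mul_add, add_mul, Finset.sum_add_distrib]
    zero_mul := fun f => by ext Z; simp [coeff_mul]
    mul_zero := fun f => by ext Z; simp [coeff_mul] }

instance : Algebra K (SkewAlgebra β) :=
  Algebra.ofModule
    (fun a f g => by
      ext Z; simp only [coeff_mul, coeff_smul, Finset.mul_sum]
      exact Finset.sum_congr rfl fun _ _ => by ring)
    (fun a f g => by
      ext Z; simp only [coeff_mul, coeff_smul, Finset.mul_sum]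
      exact Finset.sum_congr rfl fun _ _ => by ring)

theorem mono_mul_mono (X Y : Finset (Fin n)) :
    mono β X * mono β Y = if Disjoint X Y then skewCoeff β X Y • mono β (X ∪ Y) else 0 := by
  ext Z
  rw [coeff_mul]
  split_ifs with h
  · rw [coeff_smul, coeff_mono]
    split_ifs with hZ
    · subst hZ
      have e : (X ∪ Y) \ X = Y := by
        rw [Finset.union_sdiff_left, Finset.sdiff_eq_self_of_disjoint h.symm]
      rw [Finset.sum_eq_single X]
      · simp [coeff_mono, e]
      · intro W _ hW
        simp [coeff_mono, hW]
      · exact fun hn => absurd (Finset.mem_powerset.2 Finset.subset_union_left) hn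
    · rw [mul_zero]
      refine Finset.sum_eq_zero fun W hW => ?_
      simp only [coeff_mono]
      split_ifs with h1 h2 <;> try simp only [mul_zero, zero_mul]
      exact absurd (by rw [← h2, ← h1]; simp [Finset.union_eq_right.2 (Finset.mem_powerset.1 hW)]) hZ
  · rw [coeff_zero]
    refine Finset.sum_eq_zero fun W _ => ?_
    simp only [coeff_mono]
    split_ifs with h1 h2 <;> try simp only [mul_zero, zero_mul]
    exact absurd (by rw [← h1, ← h2]; exact Finset.disjoint_sdiff) h

theorem mono_ne_zero (X : Finset (Fin n)) : mono β X ≠ 0 := fun h => by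
  simpa [coeff_mono] using congrArg (fun f => coeff f X) h

theorem mono_mul_mono_ne_zero_iff (X Y : Finset (Fin n)) :
    mono β X * mono β Y ≠ 0 ↔ Disjoint X Y := by
  rw [mono_mul_mono]
  split_ifs with h
  · simp [h, skewCoeff_ne_zero, mono_ne_zero]
  · simp [h]

theorem mono_singleton_sq (i : Fin n) : mono β {i} * mono β {i} = 0 := by
  simp [mono_mul_mono]

theorem mono_singleton_comm {i j : Fin n} (h : i < j) :
    mono β {j} * mono β {i} = (β i j : K) • (mono β {i} * mono β {j}) := by
  have e : ({j} ∪ {i} : Finset (Fin n)) = {i} ∪ {j} := Finset.union_comm _ _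
  simp [mono_mul_mono, h.ne, h.ne', skewCoeff, h, h.not_gt, e]

theorem mono_insert_max {X : Finset (Fin n)} {i : Fin n} (h : ∀ j ∈ X, j < i) :
    mono β (insert i X) = mono β X * mono β {i} := by
  have hi : i ∉ X := fun hi => lt_irrefl _ (h i hi)
  have hc : skewCoeff β X {i} = 1 :=
    Finset.prod_eq_one fun j hj => by simp [(h j hj).not_gt]
  rw [mono_mul_mono, if_pos (Finset.disjoint_singleton_right.2 hi), hc, one_smul]
  rw [Finset.union_comm, Finset.insert_eq]

end SkewAlgebra

section ChiAlgebra

variable {n : ℕ} {K : Type*} [Field K]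

/-- The `χ`-boundary `∂ e_X = ∑_p (-1)^p χ(X \ i_p) e_{X \ i_p}`, where `X = {i_1 < i_2 < ⋯}` has at
least two elements, with the convention `∂ e_i = 1`. The position `p` of `i = i_p` is the number of
elements of `X` that are at most `i`. -/
def chiBoundary (β : Fin n → Fin n → Kˣ) (χ : Finset (Fin n) → K) (X : Finset (Fin n)) :
    SkewAlgebra β :=
  if X.card = 1 then 1 else
    ∑ i ∈ X, ((-1) ^ (X.filter (· ≤ i)).card * χ (X.erase i)) • SkewAlgebra.mono β (X.erase i)

/-- A set is unidependent if it contains exactly one circuit. -/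
def IsUnidependent (M : Matroid (Fin n)) (U : Finset (Fin n)) : Prop :=
  ∃! C : Finset (Fin n), M.IsCircuit (C : Set (Fin n)) ∧ C ⊆ U

/-- The two conditions on `χ : 2^[n] → K` under which the quotient is called a `χ`-algebra. -/
structure IsChiMap (M : Matroid (Fin n)) (β : Fin n → Fin n → Kˣ) (χ : Finset (Fin n) → K) :
    Prop where
  ne_zero_iff : ∀ I : Finset (Fin n), χ I ≠ 0 ↔ M.Indep (I : Set (Fin n))
  boundary : ∀ U U' : Finset (Fin n), IsUnidependent M U → IsUnidependent M U' → U' ⊆ U →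
    ∃ ε : Kˣ, chiBoundary β χ U =
      (ε : K) • (chiBoundary β χ U' * SkewAlgebra.mono β (U \ U'))

/-- The right ideal generated by the boundaries `∂ e_C` of the circuits with more than one element and
by the `e_i` with `i` a loop. Right ideals are submodules for the right multiplication action. -/
def chiIdeal (M : Matroid (Fin n)) (β : Fin n → Fin n → Kˣ) (χ : Finset (Fin n) → K) :
    Submodule (SkewAlgebra β)ᵐᵒᵖ (SkewAlgebra β) :=
  Submodule.span (SkewAlgebra β)ᵐᵒᵖ
    ({f | ∃ C : Finset (Fin n), M.IsCircuit (C : Set (Fin n)) ∧ 1 < C.card ∧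
        f = chiBoundary β χ C} ∪
      {f | ∃ i : Fin n, M.IsCircuit {i} ∧ f = SkewAlgebra.mono β {i}})

/-- The quotient `𝔸_χ(M)`, as a `K`-module. -/
abbrev ChiAlgebra (M : Matroid (Fin n)) (β : Fin n → Fin n → Kˣ) (χ : Finset (Fin n) → K) : Type _ :=
  SkewAlgebra β ⧸ chiIdeal M β χ

/-- The residue class of the monomial `e_X`. -/
def chiClass (M : Matroid (Fin n)) (β : Fin n → Fin n → Kˣ) (χ : Finset (Fin n) → K)
    (X : Finset (Fin n)) : ChiAlgebra M β χ :=
  (chiIdeal M β χ).mkQ (SkewAlgebra.mono β X)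

/-- A term order on the monomials, which are indexed by the subsets of `[n]`: a strict total order with
`e_∅ = 1` as its least element that is compatible with the nonzero products. The product of `e_X` and
`e_Z` is nonzero iff `X` and `Z` are disjoint, and its monomial is then `e_{X ∪ Z}`. -/
structure TermOrder (n : ℕ) where
  lt : Finset (Fin n) → Finset (Fin n) → Prop
  strictTotal : IsStrictTotalOrder (Finset (Fin n)) lt
  empty_lt : ∀ X : Finset (Fin n), X ≠ ∅ → lt ∅ X
  union_lt_union : ∀ X Y Z : Finset (Fin n), lt X Y → Disjoint X Z → Disjoint Y Z →
    lt (X ∪ Z) (Y ∪ Z)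

/-- `e_X` is the leading monomial of `f`. (No `X` qualifies for `f = 0`.) -/
def IsLeadingMonomial {β : Fin n → Fin n → Kˣ} (T : TermOrder n) (f : SkewAlgebra β)
    (X : Finset (Fin n)) : Prop :=
  f.coeff X ≠ 0 ∧ ∀ Y, f.coeff Y ≠ 0 → Y ≠ X → T.lt Y X

/-- The ideal generated by the leading monomials of the elements of `S`. For sets of monomials the
generated left, right and two-sided ideals agree, since monomials commute up to nonzero scalars. -/
def leadingIdeal {β : Fin n → Fin n → Kˣ} (T : TermOrder n) (S : Set (SkewAlgebra β)) :
    Submodule (SkewAlgebra β)ᵐᵒᵖ (SkewAlgebra β) :=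
  Submodule.span (SkewAlgebra β)ᵐᵒᵖ
    {m | ∃ f ∈ S, ∃ X, IsLeadingMonomial T f X ∧ m = SkewAlgebra.mono β X}

/-- `G` is a Gröbner basis of the right ideal `I` with respect to `T`. -/
structure IsGroebnerBasis {β : Fin n → Fin n → Kˣ} (T : TermOrder n)
    (I : Submodule (SkewAlgebra β)ᵐᵒᵖ (SkewAlgebra β)) (G : Set (SkewAlgebra β)) : Prop where
  subset : ∀ g ∈ G, g ∈ I ∧ g ≠ 0
  leadingIdeal_eq : leadingIdeal T G = leadingIdeal T (I : Set (SkewAlgebra β))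

/-- `G` is a reduced Gröbner basis: leading coefficients are `1`, and no term of an element of `G` is
divisible by the leading monomial of another element of `G`. -/
structure IsReducedGroebnerBasis {β : Fin n → Fin n → Kˣ} (T : TermOrder n)
    (I : Submodule (SkewAlgebra β)ᵐᵒᵖ (SkewAlgebra β)) (G : Set (SkewAlgebra β)) : Prop
    extends IsGroebnerBasis T I G where
  monic : ∀ g ∈ G, ∀ X, IsLeadingMonomial T g X → g.coeff X = 1
  not_dvd : ∀ g ∈ G, ∀ g' ∈ G, g ≠ g' → ∀ X, IsLeadingMonomial T g X →
    ∀ Y, g'.coeff Y ≠ 0 → ¬ SkewAlgebra.mono β X ∣ g'.coeff Y • SkewAlgebra.mono β Y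

/-- The classes of the standard monomials with respect to `S`, that is of the `e_X` that do not lie in
the leading ideal of `S`. -/
def canonicalBasis (M : Matroid (Fin n)) (β : Fin n → Fin n → Kˣ) (χ : Finset (Fin n) → K)
    (T : TermOrder n) (S : Set (SkewAlgebra β)) : Set (ChiAlgebra M β χ) :=
  {b | ∃ X : Finset (Fin n), SkewAlgebra.mono β X ∉ leadingIdeal T S ∧ b = chiClass M β χ X}

/-- `B` is a `π`-broken circuit: a circuit with more than one element from which the least element for
the order `i <_π j ↔ π i < π j` has been deleted. -/
def IsBrokenCircuit (M : Matroid (Fin n)) (π : Equiv.Perm (Fin n)) (B : Finset (Fin n)) : Prop :=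
  ∃ C : Finset (Fin n), M.IsCircuit (C : Set (Fin n)) ∧ 1 < C.card ∧
    ∃ a ∈ C, (∀ c ∈ C, π a ≤ π c) ∧ B = C.erase a

/-- The `π`-no broken circuit basis, as a set of classes. -/
def nbcBasis (M : Matroid (Fin n)) (β : Fin n → Fin n → Kˣ) (χ : Finset (Fin n) → K)
    (π : Equiv.Perm (Fin n)) : Set (ChiAlgebra M β χ) :=
  {b | ∃ X : Finset (Fin n), (∀ B, IsBrokenCircuit M π B → ¬ B ⊆ X) ∧ b = chiClass M β χ X}

end ChiAlgebra

end

/-! ### Coefficients, linear functionals and right ideals in the skew algebra -/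

namespace SkewAlgebra

variable {n : ℕ} {K : Type*} [Field K] {β : Fin n → Fin n → Kˣ}

/-! A term order matters only through the order it induces on the generators, that is, through a
permutation `π`. If `T` induces `π`, then `e_X` lies in the leading ideal of the `χ`-ideal exactly
when `X` contains a `π`-broken circuit (`mono_mem_leadingIdeal_chiIdeal_iff`). Every `T` induces
some `π` and every `π` is induced by some `T`, so 1 and 2 agree. Statement 3 adds only that every
right ideal has a reduced Gröbner basis (`exists_isReducedGroebnerBasis`), because a Gröbner basis
has the same standard monomials as its ideal.

One inclusion is direct: the leading monomial of `∂ e_C` is `C` without its `π`-least element. For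
the other, each `X` without broken circuits gets a dual functional `flagWeight`, built from the flag
of flats spanned by the upper segments of `X`. It vanishes on the `χ`-ideal: on boundaries this is a
Laplace expansion of a singular matrix, and the axioms on `χ` carry it to the right multiples. It is
nonzero at `e_X`. Any other `e_Y` where it is nonzero arises by moving elements of `X` upwards, so
`e_Y` exceeds `e_X`. Hence no element of the ideal can have leading monomial `e_X`. -/

theorem coeff_mul_mono (f : SkewAlgebra β) (Z W : Finset (Fin n)) :
    (f * mono β Z).coeff W =
      if Z ⊆ W then skewCoeff β (W \ Z) Z * f.coeff (W \ Z) else 0 := by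
  rw [coeff_mul]
  split_ifs with h
  · rw [Finset.sum_eq_single (W \ Z)]
    · simp [coeff_mono, Finset.sdiff_sdiff_eq_self h]
    · intro X hX hne
      rw [coeff_mono, if_neg, mul_zero, mul_zero]
      rintro rfl
      exact hne (Finset.sdiff_sdiff_eq_self (Finset.mem_powerset.1 hX)).symm
    · exact fun hn => absurd (Finset.mem_powerset.2 Finset.sdiff_subset) hn
  · refine Finset.sum_eq_zero fun X _ => ?_
    rw [coeff_mono, if_neg, mul_zero, mul_zero]
    rintro rfl
    exact h Finset.sdiff_subset

theorem coeff_mono_mul_of_not_subset (g : SkewAlgebra β) {X W : Finset (Fin n)} (h : ¬ X ⊆ W) :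
    (mono β X * g).coeff W = 0 := by
  rw [coeff_mul]
  refine Finset.sum_eq_zero fun Y hY => ?_
  rw [coeff_mono, if_neg, zero_mul, mul_zero]
  rintro rfl
  exact h (Finset.mem_powerset.1 hY)

theorem subset_of_mono_dvd {X Y : Finset (Fin n)} {a : K} (ha : a ≠ 0)
    (h : mono β X ∣ a • mono β Y) : X ⊆ Y := by
  obtain ⟨g, hg⟩ := h
  by_contra hXY
  have := congrArg (fun f => coeff f Y) hg
  simp [coeff_mono_mul_of_not_subset g hXY, coeff_mono, ha] at this

/-- The `K`-linear functional with value `w X` at the monomial `e_X`. -/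
def functional (w : Finset (Fin n) → K) : SkewAlgebra β →ₗ[K] K where
  toFun f := ∑ X, f.coeff X * w X
  map_add' f g := by simp [add_mul, Finset.sum_add_distrib]
  map_smul' a f := by simp [Finset.mul_sum, mul_assoc]

theorem functional_apply (w : Finset (Fin n) → K) (f : SkewAlgebra β) :
    functional w f = ∑ X, f.coeff X * w X := rfl

@[simp] theorem functional_mono (w : Finset (Fin n) → K) (X : Finset (Fin n)) :
    functional w (mono β X) = w X := by
  simp [functional_apply, coeff_mono]

theorem coeff_sum {ι : Type*} (s : Finset ι) (f : ι → SkewAlgebra β) (X : Finset (Fin n)) :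
    (∑ i ∈ s, f i).coeff X = ∑ i ∈ s, (f i).coeff X :=
  map_sum (⟨⟨fun f => coeff f X, fun _ _ => rfl⟩, fun _ _ => rfl⟩ : SkewAlgebra β →ₗ[K] K) f s

theorem sum_coeff_smul_mono (f : SkewAlgebra β) : ∑ X, f.coeff X • mono β X = f := by
  ext Y
  simp [coeff_sum, coeff_mono]

theorem smul_mem_right (I : Submodule (SkewAlgebra β)ᵐᵒᵖ (SkewAlgebra β)) {f : SkewAlgebra β}
    (hf : f ∈ I) (g : SkewAlgebra β) : f * g ∈ I :=
  I.smul_mem (MulOpposite.op g) hf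

/-- Right ideals are closed under passing from `e_X` to `e_Y` with `X ⊆ Y`. -/
theorem mono_mem_of_subset (I : Submodule (SkewAlgebra β)ᵐᵒᵖ (SkewAlgebra β))
    {X Y : Finset (Fin n)} (h : X ⊆ Y) (hX : mono β X ∈ I) : mono β Y ∈ I := by
  have h1 := smul_mem_right I hX (mono β (Y \ X))
  rw [mono_mul_mono, if_pos Finset.disjoint_sdiff, Finset.union_sdiff_of_subset h] at h1
  have h2 := I.smul_of_tower_mem (skewCoeff β X (Y \ X))⁻¹ h1
  rwa [smul_smul, inv_mul_cancel₀ (skewCoeff_ne_zero _ _), one_smul] at h2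

end SkewAlgebra

/-! ### Term orders and the permutations they induce -/

namespace TermOrder

variable {n : ℕ} (T : TermOrder n)

theorem irrefl (X : Finset (Fin n)) : ¬ T.lt X X :=
  letI := T.strictTotal
  irrefl_of T.lt X

theorem trans {X Y Z : Finset (Fin n)} (h : T.lt X Y) (h' : T.lt Y Z) : T.lt X Z :=
  letI := T.strictTotal
  trans_of T.lt h h'

theorem asymm {X Y : Finset (Fin n)} (h : T.lt X Y) : ¬ T.lt Y X :=
  fun h' => T.irrefl X (T.trans h h')

theorem trichotomous (X Y : Finset (Fin n)) : T.lt X Y ∨ X = Y ∨ T.lt Y X :=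
  letI := T.strictTotal
  trichotomous_of T.lt X Y

theorem wellFounded : WellFounded T.lt :=
  letI := T.strictTotal
  Finite.wellFounded_of_trans_of_irrefl T.lt

/-- The term order restricts to the generators as the order `π i < π j`. -/
def Compatible (π : Equiv.Perm (Fin n)) : Prop :=
  ∀ i j, π i < π j → T.lt {i} {j}

/-- The generators are totally ordered, so counting the generators strictly below `i` gives each `i`
a distinct rank less than `n`. -/
theorem exists_compatible : ∃ π : Equiv.Perm (Fin n), T.Compatible π := by
  classical
  let r : Fin n → ℕ := fun i => (Finset.univ.filter fun j => T.lt {j} {i}).card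
  have hmono : ∀ i j, T.lt {i} {j} → r i < r j := fun i j h => by
    refine Finset.card_lt_card (Finset.ssubset_iff_of_subset ?_ |>.2 ⟨i, ?_, ?_⟩)
    · intro a ha
      simp only [Finset.mem_filter, Finset.mem_univ, true_and] at ha ⊢
      exact T.trans ha h
    · simpa using h
    · simpa using T.irrefl {i}
  have hlt : ∀ i, r i < n := fun i => by
    have : r i < (Finset.univ : Finset (Fin n)).card := by
      refine Finset.card_lt_card (Finset.ssubset_iff_of_subset (Finset.subset_univ _) |>.2
        ⟨i, Finset.mem_univ _, ?_⟩)
      simpa using T.irrefl {i}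
    simpa using this
  let p : Fin n → Fin n := fun i => ⟨r i, hlt i⟩
  have hp : Function.Injective p := fun i j hij => by
    have hij' : r i = r j := congrArg Fin.val hij
    rcases T.trichotomous {i} {j} with h | h | h
    · exact absurd hij' (hmono i j h).ne
    · exact Finset.singleton_injective h
    · exact absurd hij' (hmono j i h).ne'
  refine ⟨Equiv.ofBijective p (Finite.injective_iff_bijective.1 hp), fun i j hij => ?_⟩
  have hij' : r i < r j := hij
  rcases T.trichotomous {i} {j} with h | h | h
  · exact h
  · rw [Finset.singleton_injective h] at hij'
    exact absurd hij' (lt_irrefl _)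
  · exact absurd hij' (hmono j i h).not_gt

/-- The term order that compares the weights `∑_{i ∈ X} 2 ^ π(i)`. -/
def ofPerm (π : Equiv.Perm (Fin n)) : TermOrder n where
  lt X Y := ∑ i ∈ X, 2 ^ (π i : ℕ) < ∑ i ∈ Y, 2 ^ (π i : ℕ)
  strictTotal := by
    -- Binary expansions are unique, so the weight determines `X`.
    have hinj : Function.Injective fun X : Finset (Fin n) => ∑ i ∈ X, 2 ^ (π i : ℕ) := by
      intro X Y h
      have h' : ∀ X : Finset (Fin n), ∑ i ∈ X, 2 ^ (π i : ℕ) =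
          ∑ k ∈ X.map (π.toEmbedding.trans Fin.valEmbedding), 2 ^ k := fun X => by
        simp
      simp only [h'] at h
      exact Finset.map_injective _ (Finset.geomSum_injective le_rfl h)
    exact { irrefl := fun X => lt_irrefl _
            trans := fun X Y Z => lt_trans
            trichotomous := fun X Y h h' => hinj (le_antisymm (not_lt.1 h') (not_lt.1 h)) }
  empty_lt X hX := by
    rw [Finset.sum_empty]
    exact Finset.sum_pos (fun _ _ => by positivity) (Finset.nonempty_iff_ne_empty.2 hX)
  union_lt_union X Y Z h hX hY := by
    rw [Finset.sum_union hX, Finset.sum_union hY]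
    exact Nat.add_lt_add_right h _

theorem ofPerm_compatible (π : Equiv.Perm (Fin n)) : (ofPerm π).Compatible π := fun i j h => by
  change ∑ i ∈ {i}, 2 ^ (π i : ℕ) < ∑ i ∈ {j}, 2 ^ (π i : ℕ)
  simpa using Nat.pow_lt_pow_right (by norm_num : 1 < 2) h

variable {T} {π : Equiv.Perm (Fin n)}

theorem Compatible.insert_lt_insert (hT : T.Compatible π) {i j : Fin n} (h : π i < π j)
    {Z : Finset (Fin n)} (hi : i ∉ Z) (hj : j ∉ Z) : T.lt (insert i Z) (insert j Z) := by
  rw [Finset.insert_eq, Finset.insert_eq]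
  exact T.union_lt_union _ _ _ (hT i j h) (Finset.disjoint_singleton_left.2 hi)
    (Finset.disjoint_singleton_left.2 hj)

/-- Moving the elements of `X` upwards injectively moves `e_X` upwards. -/
theorem Compatible.eq_or_lt_image (hT : T.Compatible π) (f : Fin n → Fin n)
    (X : Finset (Fin n)) (hinj : Set.InjOn f X) (hle : ∀ x ∈ X, π x ≤ π (f x)) :
    X = X.image f ∨ T.lt X (X.image f) := by
  -- Removing the `π`-largest element `m` ensures that `f m` lies outside the rest `S`, so `m` can
  -- be replaced by `f m` before `S` is moved.
  induction X using Finset.induction_on_max_value π with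
  | empty => simp
  | insert m S hm hmax ih =>
    have hfm : f m ∉ S.image f := by
      intro h
      obtain ⟨x, hx, hxm⟩ := Finset.mem_image.1 h
      have := hinj (by simp [hx]) (by simp) hxm
      exact hm (this ▸ hx)
    have ih' := ih (hinj.mono (by simp)) fun x hx => hle x (Finset.mem_insert_of_mem hx)
    have hle_m := hle m (Finset.mem_insert_self _ _)
    have hfmS : f m ∉ S := by
      intro h
      have h1 := π.injective (le_antisymm (hmax _ h) hle_m)
      exact hm (h1 ▸ h)
    have step1 : insert m S = insert (f m) S ∨ T.lt (insert m S) (insert (f m) S) := by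
      rcases hle_m.eq_or_lt with h | h
      · exact Or.inl (by rw [← π.injective h])
      · exact Or.inr (hT.insert_lt_insert h hm hfmS)
    have step2 : insert (f m) S = insert (f m) (S.image f) ∨
        T.lt (insert (f m) S) (insert (f m) (S.image f)) := by
      rcases ih' with h | h
      · exact Or.inl (congrArg _ h)
      · right
        rw [Finset.insert_eq, Finset.insert_eq, Finset.union_comm, Finset.union_comm {f m}]
        exact T.union_lt_union _ _ _ h (Finset.disjoint_singleton_right.2 hfmS)
          (Finset.disjoint_singleton_right.2 hfm)
    rw [Finset.image_insert]
    rcases step1 with h1 | h1 <;> rcases step2 with h2 | h2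
    · exact Or.inl (h1.trans h2)
    · exact Or.inr (h1 ▸ h2)
    · exact Or.inr (h2 ▸ h1)
    · exact Or.inr (T.trans h1 h2)

end TermOrder

/-! ### Leading ideals, normal forms and reduced Gröbner bases -/

section Leading

variable {n : ℕ} {K : Type*} [Field K] {β : Fin n → Fin n → Kˣ} {T : TermOrder n}

open SkewAlgebra

theorem exists_isLeadingMonomial (T : TermOrder n) {f : SkewAlgebra β} (hf : f ≠ 0) :
    ∃ X, IsLeadingMonomial T f X := by
  let := T.strictTotal
  have hne : {X | f.coeff X ≠ 0}.Nonempty := by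
    by_contra h
    refine hf (SkewAlgebra.ext fun X => ?_)
    by_contra hX
    exact h ⟨X, hX⟩
  have hwf : WellFounded (Function.swap T.lt) :=
    Finite.wellFounded_of_trans_of_irrefl _
  obtain ⟨X, hX, hmax⟩ := hwf.has_min _ hne
  refine ⟨X, hX, fun Y hY hYX => ?_⟩
  rcases T.trichotomous Y X with h | h | h
  · exact h
  · exact absurd h hYX
  · exact absurd h (hmax Y hY)

theorem IsLeadingMonomial.mul_mono {f : SkewAlgebra β} {X Z : Finset (Fin n)}
    (h : IsLeadingMonomial T f X) (hXZ : Disjoint X Z) :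
    IsLeadingMonomial T (f * mono β Z) (X ∪ Z) := by
  constructor
  · rw [coeff_mul_mono, if_pos Finset.subset_union_right, Finset.union_sdiff_right,
      Finset.sdiff_eq_self_of_disjoint hXZ]
    exact mul_ne_zero (skewCoeff_ne_zero _ _) h.1
  · intro W hW hne
    rw [coeff_mul_mono] at hW
    split_ifs at hW with hZ
    · have h1 := T.union_lt_union _ _ Z (h.2 _ (right_ne_zero_of_mul hW) ?_)
        Finset.sdiff_disjoint hXZ
      · rwa [Finset.sdiff_union_of_subset hZ] at h1
      · rintro rfl
        exact hne (Finset.sdiff_union_of_subset hZ).symm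
    · exact absurd rfl hW

theorem mono_mem_leadingIdeal_iff {S : Set (SkewAlgebra β)} {X : Finset (Fin n)} :
    mono β X ∈ leadingIdeal T S ↔ ∃ f ∈ S, ∃ Y, IsLeadingMonomial T f Y ∧ Y ⊆ X := by
  constructor
  · intro h
    -- The elements whose every monomial contains some leading monomial form a right ideal, since
    -- multiplication only enlarges index sets.
    have key : ∀ g ∈ leadingIdeal T S, ∀ W, g.coeff W ≠ 0 →
        ∃ f ∈ S, ∃ Y, IsLeadingMonomial T f Y ∧ Y ⊆ W := by
      intro g hg
      induction hg using Submodule.span_induction with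
      | mem g hg =>
        obtain ⟨f, hf, Y, hY, rfl⟩ := hg
        intro W hW
        refine ⟨f, hf, Y, hY, ?_⟩
        rw [coeff_mono] at hW
        split_ifs at hW with h
        · exact h.ge
        · exact absurd rfl hW
      | zero => intro W hW; exact absurd rfl hW
      | add g g' _ _ ih ih' =>
        intro W hW
        by_cases h0 : g.coeff W = 0
        · refine ih' W fun h0' => hW ?_
          rw [coeff_add, h0, h0', add_zero]
        · exact ih W h0
      | smul a g _ ih =>
        intro W hW
        have hW' : (g * a.unop).coeff W ≠ 0 := hW
        rw [coeff_mul] at hW'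
        obtain ⟨V, hV, hne⟩ := Finset.exists_ne_zero_of_sum_ne_zero hW'
        obtain ⟨f, hf, Y, hY, hYV⟩ := ih V (left_ne_zero_of_mul (right_ne_zero_of_mul hne))
        exact ⟨f, hf, Y, hY, hYV.trans (Finset.mem_powerset.1 hV)⟩
    exact key _ h X (by simp [coeff_mono])
  · rintro ⟨f, hf, Y, hY, hYX⟩
    exact mono_mem_of_subset _ hYX (Submodule.subset_span ⟨f, hf, Y, hY, rfl⟩)

/-- For a right ideal, the monomials in the leading ideal are leading monomials. -/
theorem mono_mem_leadingIdeal_coe_iff {I : Submodule (SkewAlgebra β)ᵐᵒᵖ (SkewAlgebra β)}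
    {X : Finset (Fin n)} :
    mono β X ∈ leadingIdeal T (I : Set (SkewAlgebra β)) ↔ ∃ f ∈ I, IsLeadingMonomial T f X := by
  rw [mono_mem_leadingIdeal_iff]
  constructor
  · rintro ⟨f, hf, Y, hY, hYX⟩
    refine ⟨f * mono β (X \ Y), smul_mem_right I hf _, ?_⟩
    simpa [Finset.union_sdiff_of_subset hYX] using hY.mul_mono (Z := X \ Y) Finset.disjoint_sdiff
  · rintro ⟨f, hf, hX⟩
    exact ⟨f, hf, X, hX, subset_rfl⟩

/-- Every monomial is congruent modulo `I` to a combination of standard monomials. -/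
theorem exists_normalForm (T : TermOrder n) (I : Submodule (SkewAlgebra β)ᵐᵒᵖ (SkewAlgebra β))
    (X : Finset (Fin n)) :
    ∃ h : SkewAlgebra β, mono β X - h ∈ I ∧
      ∀ Y, mono β Y ∈ leadingIdeal T (I : Set (SkewAlgebra β)) → h.coeff Y = 0 := by
  classical
  induction X using T.wellFounded.induction with
  | _ X ih =>
    by_cases hX : mono β X ∈ leadingIdeal T (I : Set (SkewAlgebra β))
    · obtain ⟨f, hf, hfX⟩ := mono_mem_leadingIdeal_coe_iff.1 hX
      choose! N hN hN0 using ih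
      let s := (Finset.univ.erase X).filter fun Y => f.coeff Y ≠ 0
      have hs : ∀ Y ∈ s, T.lt Y X := fun Y hY => by
        obtain ⟨h1, h2⟩ := Finset.mem_filter.1 hY
        exact hfX.2 Y h2 (Finset.ne_of_mem_erase h1)
      have hsum : f = f.coeff X • mono β X + ∑ Y ∈ s, f.coeff Y • mono β Y := by
        conv_lhs => rw [← sum_coeff_smul_mono f]
        rw [← Finset.add_sum_erase _ _ (Finset.mem_univ X), Finset.sum_filter_of_ne]
        intro Y _ hne h0
        exact hne (by rw [h0, zero_smul])
      -- Solve `f ≡ 0` for `e_X` and replace each smaller term by its normal form.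
      refine ⟨-(f.coeff X)⁻¹ • ∑ Y ∈ s, f.coeff Y • N Y, ?_, fun Z hZ => ?_⟩
      · have e : mono β X - -(f.coeff X)⁻¹ • ∑ Y ∈ s, f.coeff Y • N Y =
            (f.coeff X)⁻¹ • (f - ∑ Y ∈ s, f.coeff Y • (mono β Y - N Y)) := by
          have e' : f - ∑ Y ∈ s, f.coeff Y • (mono β Y - N Y) =
              f.coeff X • mono β X + ∑ Y ∈ s, f.coeff Y • N Y := by
            rw [sub_eq_iff_eq_add]
            simp only [smul_sub, Finset.sum_sub_distrib]
            refine hsum.trans ?_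
            abel
          rw [e', smul_add, smul_smul, inv_mul_cancel₀ hfX.1, one_smul, neg_smul, sub_neg_eq_add]
        rw [e]
        refine I.smul_of_tower_mem _ (I.sub_mem hf (I.sum_mem fun Y hY => ?_))
        exact I.smul_of_tower_mem _ (hN Y (hs Y hY))
      · rw [coeff_smul, coeff_sum, Finset.sum_eq_zero, mul_zero]
        intro Y hY
        rw [coeff_smul, hN0 Y (hs Y hY) Z hZ, mul_zero]
    · refine ⟨mono β X, by simp, fun Y hY => ?_⟩
      rw [coeff_mono, if_neg]
      rintro rfl
      exact hX hY

/-- Take `e_X - N X` for the inclusion-minimal `X` with `e_X` in the leading ideal, where `N X` is a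
normal form. The tail consists of standard monomials, which no leading monomial divides; minimality
excludes division between distinct leading monomials. -/
theorem exists_isReducedGroebnerBasis (T : TermOrder n)
    (I : Submodule (SkewAlgebra β)ᵐᵒᵖ (SkewAlgebra β)) :
    ∃ G, IsReducedGroebnerBasis T I G := by
  set L := leadingIdeal T (I : Set (SkewAlgebra β)) with hL
  choose N hN hN0 using exists_normalForm T I
  have hcoeff : ∀ {X Y}, mono β X ∈ L → (mono β X - N X).coeff Y ≠ 0 → Y ≠ X →
      mono β Y ∉ L := by
    intro X Y hX hne hYX hY
    refine hne ?_
    have h := coeff_add (mono β X - N X) (N X) Y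
    rwa [sub_add_cancel, coeff_mono, if_neg hYX, hN0 X Y hY, add_zero, eq_comm] at h
  have hone : ∀ {X}, mono β X ∈ L → (mono β X - N X).coeff X = 1 := by
    intro X hX
    have h := coeff_add (mono β X - N X) (N X) X
    rwa [sub_add_cancel, coeff_mono, if_pos rfl, hN0 X X hX, add_zero, eq_comm] at h
  have hne : ∀ {X}, mono β X ∈ L → mono β X - N X ≠ 0 := by
    intro X hX h0
    have h1 := hone hX
    rw [h0, coeff_zero] at h1
    exact zero_ne_one h1
  have hlead : ∀ {X}, mono β X ∈ L → IsLeadingMonomial T (mono β X - N X) X := by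
    intro X hX
    obtain ⟨Y, hY⟩ := exists_isLeadingMonomial T (hne hX)
    by_cases hYX : Y = X
    · rwa [hYX] at hY
    · exact absurd (mono_mem_leadingIdeal_coe_iff.2 ⟨_, hN X, hY⟩) (hcoeff hX hY.1 hYX)
  have huniq : ∀ {f : SkewAlgebra β} {X Y}, IsLeadingMonomial T f X → IsLeadingMonomial T f Y →
      X = Y := by
    intro f X Y hX hY
    by_contra h
    exact T.asymm (hX.2 Y hY.1 (Ne.symm h)) (hY.2 X hX.1 h)
  refine ⟨{g | ∃ X, Minimal (fun X => mono β X ∈ L) X ∧ g = mono β X - N X}, ⟨⟨?_, ?_⟩, ?_, ?_⟩⟩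
  · rintro g ⟨X, hX, rfl⟩
    exact ⟨hN X, hne hX.1⟩
  · apply le_antisymm
    · refine Submodule.span_mono ?_
      rintro m ⟨f, ⟨X, hX, rfl⟩, Y, hY, rfl⟩
      exact ⟨_, hN X, Y, hY, rfl⟩
    · refine Submodule.span_le.2 ?_
      rintro m ⟨f, hf, Y, hY, rfl⟩
      obtain ⟨X, hXY, hX⟩ := exists_minimal_le_of_wellFoundedLT (fun X => mono β X ∈ L) Y
        (mono_mem_leadingIdeal_coe_iff.2 ⟨f, hf, hY⟩)
      exact mono_mem_leadingIdeal_iff.2 ⟨_, ⟨X, hX, rfl⟩, X, hlead hX.1, hXY⟩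
  · rintro g ⟨X, hX, rfl⟩ Y hY
    rw [huniq hY (hlead hX.1)]
    exact hone hX.1
  · rintro g ⟨X, hX, rfl⟩ g' ⟨X', hX', rfl⟩ hgg' Z hZ Y hY hdvd
    rw [huniq hZ (hlead hX.1)] at hdvd
    have hXY := subset_of_mono_dvd hY hdvd
    by_cases hYX' : Y = X'
    · subst hYX'
      exact hgg' (by rw [subset_antisymm hXY (hX'.2 hX.1 hXY)])
    · exact hcoeff hX'.1 hY hYX' (mono_mem_of_subset _ hXY hX.1)

end Leading

/-! ### The flag of flats of a set and its determinant -/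

section Flag

variable {n : ℕ} (M : Matroid (Fin n)) (π : Equiv.Perm (Fin n)) (X : Finset (Fin n))

/-- `y` lies in the closure of `{z ∈ X | x ≤_π z}` but not in that of `{z ∈ X | x <_π z}`: it
appears in the flag of flats defined by `X` together with `x`. -/
def IsAtLevel (y x : Fin n) : Prop :=
  y ∈ M.closure {z | z ∈ X ∧ π x ≤ π z} ∧ y ∉ M.closure {z | z ∈ X ∧ π x < π z}

open Classical in
/-- The determinant of the incidence matrix between the elements of `Y` and the steps of the flag of
flats defined by `X`; it vanishes unless `Y` has the size of `X`. -/
noncomputable def flagSign (K : Type*) [Field K] (Y : Finset (Fin n)) : K :=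
  if h : Y.card = X.card then
    (Matrix.of fun a b : Fin X.card =>
      if IsAtLevel M π X (Y.orderEmbOfFin h a) (X.orderEmbOfFin rfl b) then (1 : K) else 0).det
  else 0

variable {M π X} {K : Type*} [Field K]

theorem IsAtLevel.mem_closure {y x : Fin n} (h : IsAtLevel M π X y x) :
    y ∈ M.closure (X : Set (Fin n)) :=
  M.closure_subset_closure (fun _ hz => hz.1) h.1

/-- The upper segments of `X` are nested, so two different levels contradict each other. -/
theorem IsAtLevel.unique {y x x' : Fin n}
    (h : IsAtLevel M π X y x) (h' : IsAtLevel M π X y x') : x = x' := by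
  rcases lt_trichotomy (π x) (π x') with hlt | heq | hlt
  · exact absurd (M.closure_subset_closure (Y := {z | z ∈ X ∧ π x < π z})
      (fun z hz => ⟨hz.1, hlt.trans_le hz.2⟩) h'.1) h.2
  · exact π.injective heq
  · exact absurd (M.closure_subset_closure (Y := {z | z ∈ X ∧ π x' < π z})
      (fun z hz => ⟨hz.1, hlt.trans_le hz.2⟩) h.1) h'.2

theorem exists_isAtLevel (hM : M.Loopless) {y : Fin n} (hy : y ∈ M.closure (X : Set (Fin n))) :
    ∃ x ∈ X, IsAtLevel M π X y x := by
  classical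
  have hempty : y ∉ M.closure ∅ := by
    have := hM.loops_eq_empty
    rw [Matroid.loops] at this
    simp [this]
  let S := X.filter fun x => y ∈ M.closure {z | z ∈ X ∧ π x ≤ π z}
  -- The `π`-least element of `s` starts an upper segment containing `s`. The level of `y` is the
  -- `π`-largest element of `S`: were `y` spanned by the elements strictly above it, this would
  -- yield a larger member of `S`.
  have hS : ∀ s : Finset (Fin n), s ⊆ X → s.Nonempty →
      y ∈ M.closure (s : Set (Fin n)) → ∃ x ∈ S, ∃ z ∈ s, π z ≤ π x := by
    intro s hs hne hys
    obtain ⟨x, hx, hmin⟩ := Finset.exists_min_image s π hne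
    refine ⟨x, Finset.mem_filter.2 ⟨hs hx, ?_⟩, x, hx, le_rfl⟩
    exact M.closure_subset_closure (Y := {z | z ∈ X ∧ π x ≤ π z})
      (fun z hz => ⟨hs hz, hmin z hz⟩) hys
  have hnonempty : ∀ s : Finset (Fin n), y ∈ M.closure (s : Set (Fin n)) → s.Nonempty := by
    intro s hs
    rw [Finset.nonempty_iff_ne_empty]
    rintro rfl
    exact hempty (by simpa using hs)
  obtain ⟨x₀, hx₀, -⟩ := hS X subset_rfl (hnonempty X hy) hy
  obtain ⟨x, hx, hmax⟩ := Finset.exists_max_image S π ⟨x₀, hx₀⟩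
  obtain ⟨hxX, hyx⟩ := Finset.mem_filter.1 hx
  refine ⟨x, hxX, hyx, fun hy' => ?_⟩
  have e : {z | z ∈ X ∧ π x < π z} = ((X.filter fun z => π x < π z : Finset (Fin n)) :
      Set (Fin n)) := by
    ext z; simp
  rw [e] at hy'
  obtain ⟨x', hx', z, hz, hzx'⟩ := hS _ (Finset.filter_subset _ _) (hnonempty _ hy') hy'
  exact absurd (hmax x' hx') (((Finset.mem_filter.1 hz).2.trans_le hzx').not_ge)

theorem isAtLevel_self_iff (hX : M.Indep (X : Set (Fin n))) {y x : Fin n} (hy : y ∈ X)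
    (hx : x ∈ X) : IsAtLevel M π X y x ↔ y = x := by
  have hE := hX.subset_ground
  have hself : IsAtLevel M π X x x := by
    refine ⟨M.mem_closure_of_mem' ⟨hx, le_rfl⟩ (hE hx), fun h => ?_⟩
    have := (hX.closure_inter_eq_self_of_subset (J := {z | z ∈ X ∧ π x < π z})
      fun _ hz => hz.1).subset ⟨h, hx⟩
    exact lt_irrefl _ this.2
  constructor
  · intro h
    have hyy : IsAtLevel M π X y y := by
      refine ⟨M.mem_closure_of_mem' ⟨hy, le_rfl⟩ (hE hy), fun h => ?_⟩
      have := (hX.closure_inter_eq_self_of_subset (J := {z | z ∈ X ∧ π y < π z})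
        fun _ hz => hz.1).subset ⟨h, hy⟩
      exact lt_irrefl _ this.2
    exact (h.unique hyy).symm
  · rintro rfl
    exact hself

theorem flagSign_self (hX : M.Indep (X : Set (Fin n))) : flagSign M π X K X = 1 := by
  classical
  rw [flagSign, dif_pos rfl]
  refine Eq.trans (congrArg Matrix.det ?_) Matrix.det_one
  ext a b
  rw [Matrix.of_apply, Matrix.one_apply]
  simp [isAtLevel_self_iff hX (X.orderEmbOfFin_mem rfl a) (X.orderEmbOfFin_mem rfl b)]

/-- A nonzero determinant has a nonzero Leibniz term, whose permutation matches each `x ∈ X` with an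
element of `Y` at level `x`. -/
theorem exists_of_flagSign_ne_zero {Y : Finset (Fin n)} (h : flagSign M π X K Y ≠ 0) :
    ∃ f : Fin n → Fin n, Set.InjOn f X ∧ X.image f = Y ∧ ∀ x ∈ X, IsAtLevel M π X (f x) x := by
  classical
  rw [flagSign] at h
  split_ifs at h with hcard
  · rw [Matrix.det_apply] at h
    obtain ⟨σ, -, hσ⟩ := Finset.exists_ne_zero_of_sum_ne_zero h
    have hσ' : ∀ b, IsAtLevel M π X (Y.orderEmbOfFin hcard (σ b)) (X.orderEmbOfFin rfl b) := by
      intro b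
      by_contra hb
      refine hσ ?_
      rw [Finset.prod_eq_zero (Finset.mem_univ b), smul_zero]
      simp [hb]
    let g : X → Fin n := fun x => Y.orderEmbOfFin hcard (σ ((X.orderIsoOfFin rfl).symm x))
    have hg : Function.Injective g := (Y.orderEmbOfFin hcard).injective.comp
      (σ.injective.comp (X.orderIsoOfFin rfl).symm.injective)
    let f : Fin n → Fin n := fun x => if hx : x ∈ X then g ⟨x, hx⟩ else x
    have hfg : ∀ x (hx : x ∈ X), f x = g ⟨x, hx⟩ := fun x hx => dif_pos hx
    have hinj : Set.InjOn f X := by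
      intro x hx x' hx' hxx'
      rw [hfg x hx, hfg x' hx'] at hxx'
      exact congrArg Subtype.val (hg hxx')
    refine ⟨f, hinj, ?_, ?_⟩
    · refine Finset.eq_of_subset_of_card_le ?_ ?_
      · intro y hy
        obtain ⟨x, hx, rfl⟩ := Finset.mem_image.1 hy
        rw [hfg x hx]
        exact Finset.orderEmbOfFin_mem _ _ _
      · rw [Finset.card_image_of_injOn hinj, hcard]
    · intro x hx
      have h1 := hσ' ((X.orderIsoOfFin rfl).symm ⟨x, hx⟩)
      rw [hfg x hx]
      rwa [← Finset.coe_orderIsoOfFin_apply X, OrderIso.apply_symm_apply] at h1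
  · exact absurd rfl h

/-- Consider a `π`-largest counterexample `x`. All elements of `X` above it are spanned by the
image, and the exchange property trades `f x` for `x` over their closure. -/
theorem subset_closure_image {f : Fin n → Fin n} (hf : ∀ x ∈ X, IsAtLevel M π X (f x) x) :
    (X : Set (Fin n)) ⊆ M.closure (X.image f : Finset (Fin n)) := by
  classical
  by_contra hnot
  have hne : (X.filter fun x => x ∉ M.closure (X.image f : Finset (Fin n))).Nonempty := by
    obtain ⟨x, hx, hx'⟩ := Set.not_subset.1 hnot
    exact ⟨x, Finset.mem_filter.2 ⟨hx, hx'⟩⟩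
  obtain ⟨x, hx, hmax⟩ := Finset.exists_max_image _ π hne
  obtain ⟨hxX, hxcl⟩ := Finset.mem_filter.1 hx
  refine hxcl ?_
  have hins : ({z | z ∈ X ∧ π x ≤ π z} : Set (Fin n)) = insert x {z | z ∈ X ∧ π x < π z} := by
    ext z
    simp only [Set.mem_ofPred_eq, Set.mem_insert_iff]
    constructor
    · rintro ⟨hz, hle⟩
      rcases hle.eq_or_lt with h | h
      · exact Or.inl (π.injective h.symm)
      · exact Or.inr ⟨hz, h⟩
    · rintro (rfl | ⟨hz, hlt⟩)
      · exact ⟨hxX, le_rfl⟩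
      · exact ⟨hz, hlt.le⟩
  obtain ⟨h1, h2⟩ := hf x hxX
  rw [hins] at h1
  have h3 := Matroid.mem_closure_insert h2 h1
  have hsub : insert (f x) {z | z ∈ X ∧ π x < π z} ⊆
      M.closure (X.image f : Finset (Fin n)) := by
    rintro z (rfl | ⟨hz, hlt⟩)
    · exact M.mem_closure_of_mem' (by simpa using ⟨x, hxX, rfl⟩)
        (M.closure_subset_ground _ h1)
    · by_contra hzcl
      exact absurd (hmax z (Finset.mem_filter.2 ⟨hz, hzcl⟩)) hlt.not_ge
  exact (M.closure_subset_closure_of_subset_closure hsub) h3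

/-- The image spans `X`, so its rank is at least `|X|`, which is also its size. -/
theorem indep_image (hX : M.Indep (X : Set (Fin n))) {f : Fin n → Fin n}
    (hinj : Set.InjOn f X) (hf : ∀ x ∈ X, IsAtLevel M π X (f x) x) :
    M.Indep ((X.image f : Finset (Fin n)) : Set (Fin n)) := by
  have h1 : M.eRk X ≤ M.eRk (X.image f : Finset (Fin n)) := by
    rw [← M.eRk_closure_eq (X.image f : Finset (Fin n))]
    exact M.eRk_mono (subset_closure_image hf)
  rw [Matroid.indep_iff_eRk_eq_encard_of_finite (Finset.finite_toSet _)]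
  refine le_antisymm (M.eRk_le_encard _) ?_
  rw [hX.eRk_eq_encard] at h1
  refine le_trans (le_of_eq ?_) h1
  rw [Set.encard_coe_eq_coe_finsetCard, Set.encard_coe_eq_coe_finsetCard,
    Finset.card_image_of_injOn hinj]

theorem indep_of_flagSign_ne_zero (hX : M.Indep (X : Set (Fin n)))
    {Y : Finset (Fin n)} (h : flagSign M π X K Y ≠ 0) : M.Indep (Y : Set (Fin n)) := by
  obtain ⟨f, hinj, rfl, hf⟩ := exists_of_flagSign_ne_zero h
  exact indep_image hX hinj hf

/-- The sum is, up to sign, the Laplace expansion along an all-ones column added to the incidence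
matrix of `U`. That matrix is singular because each element of `U` lies at exactly one level. -/
theorem sum_flagSign_erase_of_subset_closure (hM : M.Loopless) {U : Finset (Fin n)}
    (hcard : U.card = X.card + 1) (hU : (U : Set (Fin n)) ⊆ M.closure X) :
    ∑ i ∈ U, (-1) ^ (U.filter (· ≤ i)).card * flagSign M π X K (U.erase i) = 0 := by
  classical
  let u := U.orderEmbOfFin hcard
  let A : Matrix (Fin (X.card + 1)) (Fin (X.card + 1)) K := Matrix.of fun p =>
    Fin.cons 1 fun b => if IsAtLevel M π X (u p) (X.orderEmbOfFin rfl b) then (1 : K) else 0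
  have hA : A.det = 0 := by
    rw [← Matrix.exists_mulVec_eq_zero_iff]
    -- Kernel vector: the ones column equals the sum of the level columns.
    refine ⟨Fin.cons 1 fun _ => -1, fun h => one_ne_zero (congrFun h 0), ?_⟩
    ext p
    obtain ⟨x, hx, hpx⟩ := exists_isAtLevel (π := π) hM
      (hU (Finset.orderEmbOfFin_mem U hcard p))
    have hiff : ∀ b, IsAtLevel M π X (u p) (X.orderEmbOfFin rfl b) ↔
        b = (X.orderIsoOfFin rfl).symm ⟨x, hx⟩ := by
      intro b
      rw [OrderIso.eq_symm_apply, Subtype.ext_iff, Finset.coe_orderIsoOfFin_apply]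
      constructor
      · exact fun h => h.unique hpx
      · intro h
        rw [h]
        exact hpx
    simp [A, Matrix.mulVec, dotProduct, Fin.sum_univ_succ, hiff]
  have hpos : ∀ p, (U.filter (· ≤ u p)).card = p + 1 := by
    intro p
    have : U.filter (· ≤ u p) = (Finset.Iic p).map u.toEmbedding := by
      ext y
      simp only [Finset.mem_filter, Finset.mem_map, Finset.mem_Iic]
      constructor
      · rintro ⟨hy, hle⟩
        have hy' : y ∈ Set.range u := by rw [Finset.range_orderEmbOfFin]; exact hy
        obtain ⟨q, rfl⟩ := hy'
        exact ⟨q, u.le_iff_le.1 hle, rfl⟩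
      · rintro ⟨q, hq, rfl⟩
        exact ⟨Finset.orderEmbOfFin_mem _ _ _, u.le_iff_le.2 hq⟩
    rw [this, Finset.card_map, Fin.card_Iic]
  have hminor : ∀ p, flagSign M π X K (U.erase (u p)) =
      (A.submatrix p.succAbove Fin.succ).det := by
    intro p
    have hc : (U.erase (u p)).card = X.card := by
      rw [Finset.card_erase_of_mem (Finset.orderEmbOfFin_mem _ _ _), hcard]
      rfl
    have hemb : (fun a => u (p.succAbove a)) = (U.erase (u p)).orderEmbOfFin hc := by
      refine Finset.orderEmbOfFin_unique hc (fun a => ?_)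
        (u.strictMono.comp (Fin.strictMono_succAbove p))
      exact Finset.mem_erase.2
        ⟨fun h => Fin.succAbove_ne p a (u.injective h), Finset.orderEmbOfFin_mem _ _ _⟩
    rw [flagSign, dif_pos hc]
    congr 1
    ext a b
    simp [A, ← hemb]
  have hsum : ∑ i ∈ U, (-1) ^ (U.filter (· ≤ i)).card * flagSign M π X K (U.erase i) =
      ∑ p, (-1) ^ (U.filter (· ≤ u p)).card * flagSign M π X K (U.erase (u p)) := by
    conv_lhs => rw [← Finset.map_orderEmbOfFin_univ U hcard, Finset.sum_map]
    rw [Finset.map_orderEmbOfFin_univ U hcard]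
    rfl
  rw [hsum]
  rw [Matrix.det_succ_column_zero] at hA
  -- Positions in `U` count from 1 and rows from 0, hence the global sign.
  rw [← neg_eq_zero, ← Finset.sum_neg_distrib, ← hA]
  refine Finset.sum_congr rfl fun p _ => ?_
  rw [hpos, hminor]
  simp [A, pow_succ]

theorem sum_flagSign_erase (hE : M.E = Set.univ) (hM : M.Loopless)
    (hX : M.Indep (X : Set (Fin n))) {U : Finset (Fin n)} (hU : ¬ M.Indep (U : Set (Fin n))) :
    ∑ i ∈ U, (-1) ^ (U.filter (· ≤ i)).card * flagSign M π X K (U.erase i) = 0 := by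
  by_cases hcard : U.card = X.card + 1
  · by_cases hcl : (U : Set (Fin n)) ⊆ M.closure X
    · exact sum_flagSign_erase_of_subset_closure hM hcard hcl
    -- A nonzero term forces `U \ i` to be independent and inside the closure of `X`. Then `i = y`,
    -- and adding `y` back would make `U` independent.
    · obtain ⟨y, hy, hycl⟩ := Set.not_subset.1 hcl
      refine Finset.sum_eq_zero fun i hi => ?_
      by_contra hne
      obtain ⟨f, hinj, himg, hf⟩ := exists_of_flagSign_ne_zero (right_ne_zero_of_mul hne)
      have hsub : ((U.erase i : Finset (Fin n)) : Set (Fin n)) ⊆ M.closure X := by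
        intro z hz
        rw [← himg] at hz
        obtain ⟨x, hx, rfl⟩ := Finset.mem_image.1 (Finset.mem_coe.1 hz)
        exact (hf x hx).mem_closure
      have hyi : y = i := by
        by_contra h
        exact hycl (hsub (Finset.mem_coe.2 (Finset.mem_erase.2 ⟨h, hy⟩)))
      subst hyi
      have hind := indep_image hX hinj hf
      rw [himg] at hind
      refine hU ?_
      rw [← Finset.insert_erase hi, Finset.coe_insert, hind.insert_indep_iff]
      exact Or.inl ⟨by simp [hE],
        fun h => hycl (M.closure_subset_closure_of_subset_closure hsub h)⟩
  · refine Finset.sum_eq_zero fun i hi => ?_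
    rw [flagSign, dif_neg, mul_zero]
    intro h
    rw [Finset.card_erase_of_mem hi] at h
    have := Finset.card_pos.2 ⟨i, hi⟩
    omega

end Flag

/-! ### Sets without broken circuits -/

section BrokenCircuit

variable {n : ℕ} {M : Matroid (Fin n)} {π : Equiv.Perm (Fin n)} {X : Finset (Fin n)}

theorem one_lt_card_of_isCircuit (hM : M.Loopless) {C : Finset (Fin n)}
    (hC : M.IsCircuit (C : Set (Fin n))) : 1 < C.card := by
  rw [Finset.one_lt_card_iff_nontrivial]
  by_contra h
  obtain ⟨a, ha⟩ := hC.nonempty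
  have hCa : (C : Set (Fin n)) = {a} := by
    refine (Set.not_nontrivial_iff.1 ?_).eq_singleton_of_mem ha
    exact h
  rw [hCa, Matroid.singleton_isCircuit, Matroid.isLoop_iff, hM.loops_eq_empty] at hC
  exact hC

theorem exists_isBrokenCircuit (hM : M.Loopless) {C : Finset (Fin n)}
    (hC : M.IsCircuit (C : Set (Fin n))) :
    ∃ a ∈ C, (∀ c ∈ C, π a ≤ π c) ∧ IsBrokenCircuit M π (C.erase a) := by
  obtain ⟨a, ha, hmin⟩ := Finset.exists_min_image C π hC.nonempty
  exact ⟨a, ha, hmin, C, hC, one_lt_card_of_isCircuit hM hC, a, ha, hmin, rfl⟩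

theorem indep_of_no_brokenCircuit (hE : M.E = Set.univ) (hM : M.Loopless)
    (hX : ∀ B, IsBrokenCircuit M π B → ¬ B ⊆ X) : M.Indep (X : Set (Fin n)) := by
  by_contra h
  obtain ⟨C, hCX, hC⟩ := (Matroid.not_indep_iff (by simp [hE]) |>.1 h).exists_isCircuit_subset
  lift C to Finset (Fin n) using C.toFinite
  obtain ⟨a, -, -, hB⟩ := exists_isBrokenCircuit (π := π) hM hC
  exact hX _ hB ((Finset.erase_subset _ _).trans (by exact_mod_cast hCX))

/-- If `y` were `π`-below `x`, it would be the least element of a circuit whose other elements lie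
in `X`, giving a broken circuit in `X`. -/
theorem le_of_isAtLevel (hM : M.Loopless) (hX : ∀ B, IsBrokenCircuit M π B → ¬ B ⊆ X)
    {y x : Fin n} (h : IsAtLevel M π X y x) : π x ≤ π y := by
  by_contra! hlt
  obtain ⟨C, hCX, hC, hyC⟩ := Matroid.exists_isCircuit_of_mem_closure h.1
    fun hy => hlt.not_ge hy.2
  lift C to Finset (Fin n) using C.toFinite
  obtain ⟨a, ha, hmin, hB⟩ := exists_isBrokenCircuit (π := π) hM hC
  have hay : a = y := by
    rcases hCX ha with h1 | h1
    · exact h1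
    · exact absurd (h1.2.trans (hmin y hyC)) hlt.not_ge
  subst hay
  refine hX _ hB fun z hz => ?_
  obtain ⟨hne, hzC⟩ := Finset.mem_erase.1 hz
  rcases hCX hzC with h1 | h1
  · exact absurd h1 hne
  · exact h1.1

end BrokenCircuit

/-! ### The dual functionals and the leading ideal of the `χ`-ideal -/

section ChiAlgebra

open SkewAlgebra

variable {n : ℕ} {K : Type*} [Field K] {M : Matroid (Fin n)} {β : Fin n → Fin n → Kˣ}
  {χ : Finset (Fin n) → K} {π : Equiv.Perm (Fin n)} {T : TermOrder n} {X : Finset (Fin n)}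

variable (M π χ X) in
/-- The functional on the monomials that sends `e_Y` to the `χ`-normalised sign of `Y` with respect
to the flag of flats of `X`. -/
noncomputable def flagWeight (Y : Finset (Fin n)) : K := (χ Y)⁻¹ * flagSign M π X K Y

theorem flagWeight_eq_zero (hχ : IsChiMap M β χ) {Y : Finset (Fin n)}
    (hY : ¬ M.Indep (Y : Set (Fin n))) : flagWeight M χ π X Y = 0 := by
  have : χ Y = 0 := by
    by_contra h
    exact hY ((hχ.ne_zero_iff Y).1 h)
  rw [flagWeight, this, inv_zero, zero_mul]

/-- The factor `(χ Y)⁻¹` in the weight cancels the coefficients of the boundary, leaving the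
alternating sum of `flagSign`. Where `χ` vanishes the set is dependent, so `flagSign` vanishes too.
-/
theorem functional_chiBoundary (hE : M.E = Set.univ) (hM : M.Loopless) (hχ : IsChiMap M β χ)
    (hX : M.Indep (X : Set (Fin n))) {U : Finset (Fin n)} (hU : ¬ M.Indep (U : Set (Fin n)))
    (hcard : U.card ≠ 1) : functional (flagWeight M χ π X) (chiBoundary β χ U) = 0 := by
  rw [chiBoundary, if_neg hcard, map_sum, ← sum_flagSign_erase (π := π) (K := K) hE hM hX hU]
  refine Finset.sum_congr rfl fun i _ => ?_
  rw [map_smul, functional_mono, smul_eq_mul, flagWeight, mul_assoc]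
  by_cases h : χ (U.erase i) = 0
  · have h0 : flagSign M π X K (U.erase i) = 0 := by
      by_contra hne
      exact (hχ.ne_zero_iff _).2 (indep_of_flagSign_ne_zero hX hne) h
    rw [h0]
    simp
  · rw [mul_inv_cancel_left₀ h]

/-- A second circuit exists in `C ∪ Z`; circuit elimination at `i` leaves a circuit avoiding `i`. -/
theorem not_indep_erase_union {C Z : Finset (Fin n)} (hC : M.IsCircuit (C : Set (Fin n)))
    (hU : ¬ IsUnidependent M (C ∪ Z)) (i : Fin n) :
    ¬ M.Indep ((C.erase i ∪ Z : Finset (Fin n)) : Set (Fin n)) := by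
  obtain ⟨C', hC', hsub, hne⟩ : ∃ C' : Finset (Fin n), M.IsCircuit (C' : Set (Fin n)) ∧
      C' ⊆ C ∪ Z ∧ C ≠ C' := by
    by_contra! h
    exact hU ⟨C, ⟨hC, Finset.subset_union_left⟩, fun C' hC' => (h C' hC'.1 hC'.2).symm⟩
  obtain ⟨D, hD, hDc⟩ := hC.elimination hC' (fun h => hne (Finset.coe_injective h)) i
  refine fun hind => (hDc.dep.superset ?_ hind.subset_ground).not_indep hind
  intro a ha
  obtain ⟨h1, h2⟩ := hD ha
  have h2' : a ≠ i := h2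
  rw [Finset.mem_coe, Finset.mem_union, Finset.mem_erase]
  rcases h1 with h1 | h1
  · exact Or.inl ⟨h2', h1⟩
  · rcases Finset.mem_union.1 (hsub h1) with h3 | h3
    · exact Or.inl ⟨h2', h3⟩
    · exact Or.inr h3

/-- If `C` and `Z` are disjoint with unidependent union, the product is a unit multiple of `∂ e_{C ∪
Z}`. Otherwise each of its terms is zero or a multiple of a dependent monomial, where the weight
vanishes. -/
theorem functional_chiBoundary_mul_mono (hE : M.E = Set.univ) (hM : M.Loopless)
    (hχ : IsChiMap M β χ) (hX : M.Indep (X : Set (Fin n))) {C : Finset (Fin n)}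
    (hC : M.IsCircuit (C : Set (Fin n))) (Z : Finset (Fin n)) :
    functional (flagWeight M χ π X) (chiBoundary β χ C * mono β Z) = 0 := by
  have hCcard := one_lt_card_of_isCircuit hM hC
  by_cases hdis : Disjoint C Z ∧ IsUnidependent M (C ∪ Z)
  · obtain ⟨hCZ, hU⟩ := hdis
    have hCu : IsUnidependent M C := by
      refine ⟨C, ⟨hC, subset_rfl⟩, fun C' hC' => ?_⟩
      exact Finset.coe_injective (hC'.1.eq_of_subset_isCircuit hC (by exact_mod_cast hC'.2))
    obtain ⟨ε, hε⟩ := hχ.boundary _ _ hU hCu Finset.subset_union_left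
    have hdep : ¬ M.Indep ((C ∪ Z : Finset (Fin n)) : Set (Fin n)) := fun h =>
      hC.dep.not_indep (h.subset (by simp))
    have h0 := functional_chiBoundary (π := π) hE hM hχ hX hdep (by
      have := Finset.card_le_card (Finset.subset_union_left (s₁ := C) (s₂ := Z))
      omega)
    rw [hε, map_smul, Finset.union_sdiff_left, Finset.sdiff_eq_self_of_disjoint hCZ.symm] at h0
    exact (smul_eq_zero.1 h0).resolve_left ε.ne_zero
  · rw [chiBoundary, if_neg hCcard.ne', Finset.sum_mul, map_sum]
    refine Finset.sum_eq_zero fun i hi => ?_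
    rw [smul_mul_assoc, map_smul, mono_mul_mono]
    split_ifs with hd
    · rw [map_smul, functional_mono, flagWeight_eq_zero hχ, smul_zero, smul_zero]
      by_cases hiZ : i ∈ Z
      · intro h
        refine hC.dep.not_indep (h.subset fun a ha => ?_)
        rw [Finset.mem_coe, Finset.mem_union, Finset.mem_erase]
        by_cases hai : a = i
        · exact Or.inr (hai ▸ hiZ)
        · exact Or.inl ⟨hai, ha⟩
      · refine not_indep_erase_union hC (fun hU => hdis ⟨?_, hU⟩) i
        rw [← Finset.insert_erase hi]
        exact Finset.disjoint_insert_left.2 ⟨hiZ, hd⟩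
    · rw [map_zero, smul_zero]

theorem functional_eq_zero_of_mem_chiIdeal (hE : M.E = Set.univ) (hM : M.Loopless)
    (hχ : IsChiMap M β χ) (hX : M.Indep (X : Set (Fin n))) {f : SkewAlgebra β}
    (hf : f ∈ chiIdeal M β χ) : functional (flagWeight M χ π X) f = 0 := by
  -- Vanishing on all right multiples is what survives the induction over a right ideal.
  have key : ∀ g : SkewAlgebra β, functional (flagWeight M χ π X) (f * g) = 0 := by
    induction hf using Submodule.span_induction with
    | mem f hf =>
      intro g
      rcases hf with ⟨C, hC, -, rfl⟩ | ⟨i, hi, -⟩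
      · rw [← sum_coeff_smul_mono g, Finset.mul_sum, map_sum]
        refine Finset.sum_eq_zero fun Z _ => ?_
        rw [mul_smul_comm, map_smul, functional_chiBoundary_mul_mono hE hM hχ hX hC, smul_zero]
      · rw [Matroid.singleton_isCircuit, Matroid.isLoop_iff, hM.loops_eq_empty] at hi
        exact hi.elim
    | zero => simp
    | add f f' _ _ ih ih' => intro g; rw [add_mul, map_add, ih, ih', add_zero]
    | smul a f _ ih =>
      intro g
      change functional _ (f * a.unop * g) = 0
      rw [mul_assoc, ih]
  simpa using key 1

/-- `C \ i` and `C \ a` differ by exchanging `a` for the `π`-larger `i`. The coefficient at `C \ a`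
is nonzero because a circuit minus a point is independent. -/
theorem isLeadingMonomial_chiBoundary (hχ : IsChiMap M β χ) (hT : T.Compatible π)
    {C : Finset (Fin n)} (hC : M.IsCircuit (C : Set (Fin n))) (hcard : 1 < C.card) {a : Fin n}
    (ha : a ∈ C) (hmin : ∀ c ∈ C, π a ≤ π c) :
    IsLeadingMonomial T (chiBoundary β χ C) (C.erase a) := by
  have hcoeff : ∀ Y, (chiBoundary β χ C).coeff Y = ∑ i ∈ C,
      if Y = C.erase i then (-1) ^ (C.filter (· ≤ i)).card * χ (C.erase i) else 0 := by
    intro Y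
    rw [chiBoundary, if_neg hcard.ne', coeff_sum]
    refine Finset.sum_congr rfl fun i _ => ?_
    rw [coeff_smul, coeff_mono, mul_ite, mul_one, mul_zero]
  constructor
  · rw [hcoeff, Finset.sum_eq_single a]
    · rw [if_pos rfl]
      refine mul_ne_zero (pow_ne_zero _ (neg_ne_zero.2 one_ne_zero)) ((hχ.ne_zero_iff _).2 ?_)
      refine hC.ssubset_indep ?_
      exact_mod_cast Finset.erase_ssubset ha
    · intro i hi hia
      refine if_neg fun h => ?_
      have : i ∈ C.erase a := Finset.mem_erase.2 ⟨hia, hi⟩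
      rw [h] at this
      exact Finset.notMem_erase _ _ this
    · exact fun h => absurd ha h
  · intro Y hY hne
    rw [hcoeff] at hY
    obtain ⟨i, hi, hYi⟩ := Finset.exists_ne_zero_of_sum_ne_zero hY
    split_ifs at hYi with h
    · subst h
      have hia : i ≠ a := fun h => hne (by rw [h])
      have hlt : π a < π i := (hmin i hi).lt_of_ne fun h => hia (π.injective h).symm
      have h1 := hT.insert_lt_insert hlt (Z := (C.erase i).erase a) (by simp) (by simp)
      rwa [Finset.insert_erase (Finset.mem_erase.2 ⟨hia.symm, ha⟩), Finset.erase_right_comm,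
        Finset.insert_erase (Finset.mem_erase.2 ⟨hia, hi⟩)] at h1
    · exact absurd rfl hYi

/-- The leading ideal of the `χ`-ideal is generated by the broken circuits. -/
theorem mono_mem_leadingIdeal_chiIdeal_iff (hE : M.E = Set.univ) (hM : M.Loopless)
    (hχ : IsChiMap M β χ) (hT : T.Compatible π) :
    mono β X ∈ leadingIdeal T (chiIdeal M β χ : Set (SkewAlgebra β)) ↔
      ∃ B, IsBrokenCircuit M π B ∧ B ⊆ X := by
  constructor
  · intro h
    obtain ⟨f, hf, hfX⟩ := mono_mem_leadingIdeal_coe_iff.1 h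
    by_contra! hX
    have hind := indep_of_no_brokenCircuit hE hM hX
    have h0 := functional_eq_zero_of_mem_chiIdeal (π := π) hE hM hχ hind hf
    -- Only `e_X` contributes: the monomials of `f` lie at or below `X`, and the support of the
    -- weight at or above it.
    rw [functional_apply, Finset.sum_eq_single X, flagWeight, flagSign_self hind, mul_one] at h0
    · exact mul_ne_zero hfX.1 (inv_ne_zero ((hχ.ne_zero_iff X).2 hind)) h0
    · intro Y _ hYX
      by_contra hne
      obtain ⟨g, hinj, rfl, hg⟩ := exists_of_flagSign_ne_zero
        (right_ne_zero_of_mul (right_ne_zero_of_mul hne))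
      have hlt := hfX.2 _ (left_ne_zero_of_mul hne) hYX
      rcases hT.eq_or_lt_image g X hinj fun x hx => le_of_isAtLevel hM hX (hg x hx) with h1 | h1
      · exact hYX h1.symm
      · exact T.asymm h1 hlt
    · exact fun h => absurd (Finset.mem_univ X) h
  · rintro ⟨B, ⟨C, hC, hcard, a, ha, hmin, rfl⟩, hBX⟩
    exact mono_mem_leadingIdeal_iff.2 ⟨_, Submodule.subset_span (Or.inl ⟨C, hC, hcard, rfl⟩), _,
      isLeadingMonomial_chiBoundary hχ hT hC hcard ha hmin, hBX⟩

/-- This carries the equivalence of 1 and 2: the right-hand side depends on `T` only through `π`. -/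
theorem canonicalBasis_chiIdeal (hE : M.E = Set.univ) (hM : M.Loopless) (hχ : IsChiMap M β χ)
    (hT : T.Compatible π) :
    canonicalBasis M β χ T (chiIdeal M β χ : Set (SkewAlgebra β)) = nbcBasis M β χ π := by
  ext b
  simp only [canonicalBasis, nbcBasis, mono_mem_leadingIdeal_chiIdeal_iff hE hM hχ hT,
    not_exists, not_and]

theorem canonicalBasis_of_isGroebnerBasis {G : Set (SkewAlgebra β)}
    (hG : IsGroebnerBasis T (chiIdeal M β χ) G) :
    canonicalBasis M β χ T G = canonicalBasis M β χ T (chiIdeal M β χ : Set (SkewAlgebra β)) := by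
  rw [canonicalBasis, hG.leadingIdeal_eq, canonicalBasis]

end ChiAlgebra

theorem mainTheorem3 {n : ℕ} {K : Type*} [Field K] (M : Matroid (Fin n)) (hE : M.E = Set.univ)
    (hM : M.Loopless) (β : Fin n → Fin n → Kˣ) (χ : Finset (Fin n) → K) (hχ : IsChiMap M β χ)
    (B : Set (ChiAlgebra M β χ)) (hli : LinearIndepOn K id B) (hspan : Submodule.span K B = ⊤) :
    List.TFAE
      [∃ T : TermOrder n,
          B = canonicalBasis M β χ T (chiIdeal M β χ : Set (SkewAlgebra β)),
        ∃ π : Equiv.Perm (Fin n), B = nbcBasis M β χ π,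
        ∃ (T : TermOrder n) (G : Set (SkewAlgebra β)),
          IsReducedGroebnerBasis T (chiIdeal M β χ) G ∧ B = canonicalBasis M β χ T G] := by
  tfae_have 1 → 2
  | ⟨T, hB⟩ => by
    obtain ⟨π, hπ⟩ := T.exists_compatible
    exact ⟨π, hB.trans (canonicalBasis_chiIdeal hE hM hχ hπ)⟩
  tfae_have 2 → 1
  | ⟨π, hB⟩ => ⟨TermOrder.ofPerm π,
      hB.trans (canonicalBasis_chiIdeal hE hM hχ (TermOrder.ofPerm_compatible π)).symm⟩
  tfae_have 1 → 3
  | ⟨T, hB⟩ => by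
    obtain ⟨G, hG⟩ := exists_isReducedGroebnerBasis T (chiIdeal M β χ)
    exact ⟨T, G, hG, hB.trans (canonicalBasis_of_isGroebnerBasis hG.toIsGroebnerBasis).symm⟩
  tfae_have 3 → 1
  | ⟨T, G, hG, hB⟩ => ⟨T, hB.trans (canonicalBasis_of_isGroebnerBasis hG.toIsGroebnerBasis)⟩
  tfae_finish
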